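/- \textbf{Theorem 1 (general clustering consistency under the Bayesian spanning forest, BSF).} Fix oracle labels $z^*=(z^*_i)_{i\ge1}\in(\mathbb N^+)^\infty$. For each $n$ let the data $y_1,\dots,y_n$ be independent with $y_i\sim G^{0,n}_{z^*_i}$, where the $G^{0,n}_k$ are probability distributions on a space $\mathcal Y_n$, and let $P_0^{(n)}$ be the law of $y^{(n)}=(y_1,\dots,y_n)$. The oracle partition $(V^{0,n}_1,\dots,V^{0,n}_{K_{0,n}})$ of $[n]$ consists of the $K_{0,n}$ non-empty sets among $\{i\le n: z_i^*=k\}$, $k\in\mathbb N^+$. Write $s\sim t$ if $z^*_s=z^*_t$. \emph{Model.} Let $\delta_n,\lambda_n>0$, let $r_n\ge0$ be a (root) kernel on $\mathcal Y_n$ and $f_n(x\mid x')=f_n(x'\mid x)\ge0$ a symmetric (leaf) kernel, both measurable. For a labelled partition $\mathcal V=(V_1,\dots,V_K)$ of $[n]$ into non-empty clusters put $$\Pi^*(\mathcal V\mid y^{(n)})=\frac{w(\mathcal V)}{\sum_{\mathcal V'}w(\mathcal V')},\qquad w(\mathcal V)=\lambda_n^{K}\sum_{(E_k,k^*)_{k\le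 K}}\ \prod_{k=1}^{K}\Big[r_n(y_{k^*})\prod_{(i,j)\in E_k}f_n(y_i\mid y_j)\Big],$$ where $\mathcal V'$ runs over all labelled partitions of $[n]$ (any number of clusters), and the inner sum is over all choices, for each $k$, of a spanning tree of $V_k$ with root $k^*\in V_k$ and edge set $E_k$ ($(i,j)\in E_k$ meaning that $j$ is the parent of $i$). Two labelled partitions are equivalent ($\sim$) if they agree up to relabelling of the clusters, and $\Pi(\mathcal V_n\not\sim\mathcal V_0\mid y^{(n)})$ denotes the sum of $\Pi^*(\mathcal V\mid y^{(n)})$ over all $\mathcal V\not\sim\mathcal V_0$. \emph{Assumptions.} (i) There are constants $C_1,C_2>0$ such that for all sufficiently large $n$, $P_0^{(n)}$-almost surely, $C_1\delta_n\le\min_{i\le n}r_n(y_i)\le\max_{i\le n}r_n(y_i)\le C_2\delta_n$. (ii) $K_{0,n}=o(\sqrt n)$. (iii) For some constants $\phi=(c_1,c_2,\iota_1,\iota_2)$, all positive and independent of $n$, $P_0^{(n)}(y^{(n)}\notin\mathcal D^{(n)}_\phi)\to0$ as $n\to\infty$, where $\mathcal D^{(n)}_\phi$ is the set of $y^{(n)}$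 with $$\frac{\max_{s\not\sim t}f_n(y_t\mid y_s)}{\delta_n\lambda_n}\le c_1(K_{0,n}-1+\iota_1)^{-n}\quad\text{and}\quad\frac{\delta_n\lambda_n}{\min_{s\sim t,\ s\ne t}f_n(y_t\mid y_s)}\le c_2(K_{0,n}+1+\iota_2)^{-n},\qquad s,t\in[n];$$ a condition whose maximum or minimum runs over no pair is void, and a ratio with denominator $0$ is $+\infty$. \emph{Conclusion.} $$\mathbb E_{P_0^{(n)}}\big[\Pi(\mathcal V_n\not\sim(V^{0,n}_1,\dots,V^{0,n}_{K_{0,n}})\mid y^{(n)})\big]\longrightarrow0\quad\text{as }n\to\infty.$$ -/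

import Mathlib

open Filter Topology MeasureTheory Asymptotics
open scoped Classical

noncomputable section

namespace BSF

/-- A labelled partition `(V_1, …, V_K)` of `[n]`: non-empty, pairwise disjoint clusters covering
`[n]`. Non-empty disjoint clusters force `K ≤ n`, so bounding `K` by `n` excludes nothing. -/
abbrev LabeledPartition (n : ℕ) : Type :=
  Σ K : Fin (n + 1), {V : Fin (K : ℕ) → Finset (Fin n) //
    (∀ k, (V k).Nonempty) ∧ (∀ k l, k ≠ l → Disjoint (V k) (V l)) ∧ ∀ i, ∃ k, i ∈ V k}

/-- The number `K` of clusters. -/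
abbrev LabeledPartition.size {n : ℕ} (𝒱 : LabeledPartition n) : ℕ := (𝒱.1 : ℕ)

/-- The cluster `V_k`. -/
abbrev LabeledPartition.block {n : ℕ} (𝒱 : LabeledPartition n) (k : Fin 𝒱.size) :
    Finset (Fin n) := 𝒱.2.1 k

/-- Equality of partitions up to relabelling; a bijection of the label sets exists only if the
numbers of clusters agree. -/
def Equivalent {n : ℕ} (𝒱 𝒲 : LabeledPartition n) : Prop :=
  ∃ ψ : Fin 𝒱.size ≃ Fin 𝒲.size, ∀ k, 𝒱.block k = 𝒲.block (ψ k)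

/-- `E` is the edge set of a spanning tree of `V` rooted at `root`, with its edges directed away
from the root. A pair `(i, j) ∈ E` is the edge from the parent `j` to its child `i`. -/
structure IsRootedSpanningTree {n : ℕ} (V : Finset (Fin n)) (E : Finset (Fin n × Fin n))
    (root : Fin n) : Prop where
  root_mem : root ∈ V
  edge_mem : ∀ i j, (i, j) ∈ E → i ∈ V ∧ j ∈ V
  root_no_parent : ∀ j, (root, j) ∉ E
  unique_parent : ∀ i ∈ V, i ≠ root → ∃! j, (i, j) ∈ E
  reaches_root : ∀ i ∈ V, Relation.ReflTransGen (fun a b => (a, b) ∈ E) i root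

section Posterior

variable {n : ℕ} {Y : Type*}

/-- Likelihood of the data given a forest: the product over the trees of the root kernel at the
root and of the leaf kernels `f i j = f(y_i ∣ y_j)` along the edges. -/
def likelihood (r : Y → ℝ) (f : Y → Y → ℝ) (y : Fin n → Y) {K : ℕ}
    (E : Fin K → Finset (Fin n × Fin n)) (R : Fin K → Fin n) : ℝ :=
  ∏ k, (r (y (R k)) * ∏ e ∈ E k, f (y e.1) (y e.2))

/-- Unnormalised integrated posterior weight of a labelled partition: likelihood times the prior
weight `lam ^ K`, summed over all choices of a rooted spanning tree in every cluster. -/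
def weight (r : Y → ℝ) (f : Y → Y → ℝ) (lam : ℝ) (y : Fin n → Y) (𝒱 : LabeledPartition n) : ℝ :=
  ∑ E : Fin 𝒱.size → Finset (Fin n × Fin n), ∑ R : Fin 𝒱.size → Fin n,
    if ∀ k, IsRootedSpanningTree (𝒱.block k) (E k) (R k) then
      likelihood r f y E R * lam ^ 𝒱.size
    else 0

/-- The integrated posterior probability of a labelled partition. -/
def labeledPosterior (r : Y → ℝ) (f : Y → Y → ℝ) (lam : ℝ) (y : Fin n → Y)
    (𝒱 : LabeledPartition n) : ℝ :=
  weight r f lam y 𝒱 / ∑ 𝒲 : LabeledPartition n, weight r f lam y 𝒲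

/-- Posterior probability that the partition is not equivalent to `𝒱₀`. -/
def posteriorNotEquivalent (r : Y → ℝ) (f : Y → Y → ℝ) (lam : ℝ) (y : Fin n → Y)
    (𝒱₀ : LabeledPartition n) : ℝ :=
  ∑ 𝒱 : LabeledPartition n,
    if Equivalent 𝒱 𝒱₀ then 0 else labeledPosterior r f lam y 𝒱

end Posterior

section Oracle

/-- The labels of the oracle clusters that are non-empty at sample size `n`. -/
def oracleLabels (z : ℕ → ℕ) (n : ℕ) : Finset ℕ :=
  Finset.univ.image (fun i : Fin n => z i)

/-- The true number of clusters at sample size `n`. -/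
def oracleSize (z : ℕ → ℕ) (n : ℕ) : ℕ := (oracleLabels z n).card

theorem oracleSize_le (z : ℕ → ℕ) (n : ℕ) : oracleSize z n ≤ n := by
  have h := Finset.card_image_le (s := (Finset.univ : Finset (Fin n))) (f := fun i : Fin n => z i)
  rw [Finset.card_univ, Fintype.card_fin] at h
  exact h

/-- The oracle partition of `[n]`: the non-empty sets `{i : z i = ℓ}`, listed by increasing `ℓ`. -/
def oraclePartition (z : ℕ → ℕ) (n : ℕ) : LabeledPartition n :=
  ⟨⟨oracleSize z n, Nat.lt_succ_of_le (oracleSize_le z n)⟩,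
    fun k => Finset.univ.filter (fun i : Fin n => z i = (oracleLabels z n).orderEmbOfFin rfl k), by
      refine ⟨fun k => ?_, fun k l hkl => ?_, fun i => ?_⟩
      · have h := Finset.orderEmbOfFin_mem (oracleLabels z n) rfl k
        obtain ⟨i, -, hi⟩ := Finset.mem_image.1 h
        exact ⟨i, Finset.mem_filter.2 ⟨Finset.mem_univ i, hi⟩⟩
      · rw [Finset.disjoint_left]
        intro i hi hi'
        have h1 := (Finset.mem_filter.1 hi).2
        have h2 := (Finset.mem_filter.1 hi').2
        exact hkl (((oracleLabels z n).orderEmbOfFin rfl).injective (h1.symm.trans h2))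
      · have h : z i ∈ Set.range ((oracleLabels z n).orderEmbOfFin rfl) := by
          rw [Finset.range_orderEmbOfFin]
          exact Finset.mem_coe.2 (Finset.mem_image_of_mem (fun i : Fin n => z i) (Finset.mem_univ i))
        obtain ⟨k, hk⟩ := h
        exact ⟨k, Finset.mem_filter.2 ⟨Finset.mem_univ i, hk.symm⟩⟩⟩

/-- The oracle law of the sample: independent `y_i`, with `y_i` distributed as `G (z i)`. -/
def oracleLaw {Y : Type*} [MeasurableSpace Y] (G : ℕ → Measure Y) (z : ℕ → ℕ) (n : ℕ) :
    Measure (Fin n → Y) :=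
  Measure.pi (fun i : Fin n => G (z i))

/-- The nice set of samples. The bounds on the maximum and on the minimum of the kernels are
written for every pair; the kernel of a point with itself plays no role. A vanishing
within-cluster kernel (infinite ratio) is excluded. -/
def niceSet {Y : Type*} (f : Y → Y → ℝ) (δ lam : ℝ) (z : ℕ → ℕ) (c₁ c₂ ι₁ ι₂ : ℝ) (n : ℕ) :
    Set (Fin n → Y) :=
  {y | (∀ s t : Fin n, z s ≠ z t →
          f (y t) (y s) / (δ * lam) ≤ c₁ * ((oracleSize z n : ℝ) - 1 + ι₁) ^ (-(n : ℤ))) ∧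
       (∀ s t : Fin n, s ≠ t → z s = z t → 0 < f (y t) (y s) ∧
          (δ * lam) / f (y t) (y s) ≤ c₂ * ((oracleSize z n : ℝ) + 1 + ι₂) ^ (-(n : ℤ)))}

end Oracle

end BSF

end

/-! A spanning forest is a parent map `p` whose fixed points are the roots, and its weight is a
product over vertices: `lam * r` at a root, the leaf kernel at a child. On a nice sample, with `a =
δ * lam`, a root costs about `a`, an edge between labels at most `a * ε`, and an edge within a label
at least `a * M`, where `ε` is exponentially small and `M` exponentially large in `n`.

Every forest is compared with a forest of the oracle partition. A vertex is exposed if it is a root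
or its parent has another label. In each label class one exposed vertex becomes the root, and the
other exposed vertices are attached to it (`IsRegrafting.isLabelForest`). Vertex by vertex the
weight loses at most a bounded factor at each of the `oracleSize` remaining roots, and it gains an
exponentially large factor at least once unless the forest already induced the oracle partition.

The original forest is recovered from the regrafted one, the ordered tuple of roots and the set of
cross-label edges (`IsRegrafting.eq_of_eq`). To pay for this multiplicity, a factor `n ^ 2` is
charged to each exposed vertex; summing the reciprocals over all tuples and edge sets gives at most
`3 * (n + 1)` (`sum_inv_pow_sigma`, `sum_inv_pow_card_le`). The posterior mass off the oracle
partition is thus at most `3 * (n + 1) * (B ^ oracleSize z n * η)`, with `B` of order `n ^ 2` and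
`η` of order `n ^ 2 * q ^ (-n)`, `q > 1`. Since the number of clusters is `o(√n)`, the power of `B`
is subexponential and the bound tends to zero. -/

namespace BSF

/-! ### Rooted spanning forests as parent maps. -/

/-- `p` sends every vertex of a spanning forest to its parent, the roots being its fixed points. -/
structure IsParentMap {n : ℕ} (𝒱 : LabeledPartition n)
    (E : Fin 𝒱.size → Finset (Fin n × Fin n)) (R : Fin 𝒱.size → Fin n) (p : Fin n → Fin n) :
    Prop where
  root_mem : ∀ k, R k ∈ 𝒱.block k
  fixed_iff : ∀ k, ∀ i ∈ 𝒱.block k, p i = i ↔ i = R k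
  mem_block : ∀ k, ∀ i ∈ 𝒱.block k, p i ∈ 𝒱.block k
  mem_edges : ∀ k i j, (i, j) ∈ E k ↔ i ∈ 𝒱.block k ∧ i ≠ R k ∧ p i = j
  reaches : ∀ k, ∀ i ∈ 𝒱.block k, ∃ t : ℕ, p^[t] i = R k

theorem LabeledPartition.block_unique {n : ℕ} (𝒱 : LabeledPartition n) {i : Fin n}
    {k l : Fin 𝒱.size} (hk : i ∈ 𝒱.block k) (hl : i ∈ 𝒱.block l) : k = l := by
  by_contra h
  exact Finset.disjoint_left.1 (𝒱.2.2.2.1 k l h) hk hl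

theorem LabeledPartition.exists_block {n : ℕ} (𝒱 : LabeledPartition n) (i : Fin n) :
    ∃ k, i ∈ 𝒱.block k := 𝒱.2.2.2.2 i

/-- A loop at `i` would be the only edge leaving `i`, so no path could lead from `i` to the root. -/
theorem IsRootedSpanningTree.not_edge_self {n : ℕ} {V : Finset (Fin n)}
    {E : Finset (Fin n × Fin n)} {ρ : Fin n} (h : IsRootedSpanningTree V E ρ) (i : Fin n) :
    (i, i) ∉ E := by
  intro hi
  have hiV := (h.edge_mem i i hi).1
  have hne : i ≠ ρ := fun e => h.root_no_parent i (e ▸ hi)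
  have key : ∀ b, Relation.ReflTransGen (fun a b => (a, b) ∈ E) i b → b = i := by
    intro b hb
    induction hb with
    | refl => rfl
    | tail _ hbc ih =>
      subst ih
      exact (h.unique_parent _ hiV hne).unique hbc hi
  exact hne (key _ (h.reaches_root i hiV)).symm

theorem exists_isParentMap {n : ℕ} (𝒱 : LabeledPartition n)
    (E : Fin 𝒱.size → Finset (Fin n × Fin n)) (R : Fin 𝒱.size → Fin n)
    (h : ∀ k, IsRootedSpanningTree (𝒱.block k) (E k) (R k)) :
    ∃ p, IsParentMap 𝒱 E R p := by
  have hex : ∀ i, ∃ j, ∀ k, i ∈ 𝒱.block k →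
      (i = R k → j = i) ∧ (i ≠ R k → (i, j) ∈ E k) := by
    intro i
    obtain ⟨k, hk⟩ := 𝒱.exists_block i
    by_cases hi : i = R k
    · refine ⟨i, fun l hl => ?_⟩
      obtain rfl := 𝒱.block_unique hk hl
      exact ⟨fun _ => rfl, fun h => absurd hi h⟩
    · obtain ⟨j, hj, -⟩ := (h k).unique_parent i hk hi
      refine ⟨j, fun l hl => ?_⟩
      obtain rfl := 𝒱.block_unique hk hl
      exact ⟨fun h => absurd h hi, fun _ => hj⟩
  choose p hp using hex
  have hedge : ∀ k i j, (i, j) ∈ E k ↔ i ∈ 𝒱.block k ∧ i ≠ R k ∧ p i = j := by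
    intro k i j
    constructor
    · intro hij
      have hi := ((h k).edge_mem i j hij).1
      have hne : i ≠ R k := fun e => (h k).root_no_parent j (e ▸ hij)
      exact ⟨hi, hne, ((h k).unique_parent i hi hne).unique ((hp i k hi).2 hne) hij⟩
    · rintro ⟨hi, hne, rfl⟩
      exact (hp i k hi).2 hne
  refine ⟨p, fun k => (h k).root_mem, fun k i hi => ⟨fun hpi => ?_, (hp i k hi).1⟩,
    fun k i hi => ?_, hedge, fun k i hi => ?_⟩
  · by_contra hne
    have := (hp i k hi).2 hne
    rw [hpi] at this
    exact (h k).not_edge_self i this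
  · by_cases hne : i = R k
    · rwa [(hp i k hi).1 hne]
    · exact ((h k).edge_mem _ _ ((hp i k hi).2 hne)).2
  · have := (h k).reaches_root i hi
    induction this using Relation.ReflTransGen.head_induction_on with
    | refl => exact ⟨0, rfl⟩
    | head hab _ ih =>
      obtain ⟨t, ht⟩ := ih ((h k).edge_mem _ _ hab).2
      refine ⟨t + 1, ?_⟩
      rw [Function.iterate_succ_apply, ((hedge k _ _).1 hab).2.2, ht]

theorem IsParentMap.isRootedSpanningTree {n : ℕ} {𝒱 : LabeledPartition n}
    {E : Fin 𝒱.size → Finset (Fin n × Fin n)} {R : Fin 𝒱.size → Fin n} {p : Fin n → Fin n}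
    (h : IsParentMap 𝒱 E R p) (k : Fin 𝒱.size) :
    IsRootedSpanningTree (𝒱.block k) (E k) (R k) where
  root_mem := h.root_mem k
  edge_mem i j hij := by
    obtain ⟨hi, -, rfl⟩ := (h.mem_edges k i j).1 hij
    exact ⟨hi, h.mem_block k i hi⟩
  root_no_parent j hj := ((h.mem_edges k _ j).1 hj).2.1 rfl
  unique_parent i hi hne :=
    ⟨p i, (h.mem_edges k i _).2 ⟨hi, hne, rfl⟩, fun _ hj => ((h.mem_edges k i _).1 hj).2.2.symm⟩
  reaches_root i hi := by
    obtain ⟨t, ht⟩ := h.reaches k i hi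
    induction t generalizing i with
    | zero =>
      obtain rfl : i = R k := ht
      exact Relation.ReflTransGen.refl
    | succ t ih =>
      by_cases hne : i = R k
      · rw [hne]
      · rw [Function.iterate_succ_apply] at ht
        exact Relation.ReflTransGen.head ((h.mem_edges k i _).2 ⟨hi, hne, rfl⟩)
          (ih _ (h.mem_block k i hi) ht)

theorem IsParentMap.fixed_iff_mem_range {n : ℕ} {𝒱 : LabeledPartition n}
    {E : Fin 𝒱.size → Finset (Fin n × Fin n)} {R : Fin 𝒱.size → Fin n} {p : Fin n → Fin n}
    (h : IsParentMap 𝒱 E R p) (i : Fin n) : p i = i ↔ i ∈ Set.range R := by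
  obtain ⟨k, hk⟩ := 𝒱.exists_block i
  rw [h.fixed_iff k i hk]
  constructor
  · rintro rfl
    exact ⟨k, rfl⟩
  · rintro ⟨l, rfl⟩
    rw [𝒱.block_unique hk (h.root_mem l)]

theorem IsParentMap.root_injective {n : ℕ} {𝒱 : LabeledPartition n}
    {E : Fin 𝒱.size → Finset (Fin n × Fin n)} {R : Fin 𝒱.size → Fin n} {p : Fin n → Fin n}
    (h : IsParentMap 𝒱 E R p) : Function.Injective R := fun k l hkl =>
  𝒱.block_unique (h.root_mem k) (hkl ▸ h.root_mem l)

/-- Blocks are closed under `p`, so an orbit that meets a root stays in that root's block. Hence `p`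
and `R` alone determine the labelled partition. -/
theorem IsParentMap.mem_block_iff {n : ℕ} {𝒱 : LabeledPartition n}
    {E : Fin 𝒱.size → Finset (Fin n × Fin n)} {R : Fin 𝒱.size → Fin n} {p : Fin n → Fin n}
    (h : IsParentMap 𝒱 E R p) (k : Fin 𝒱.size) (i : Fin n) :
    i ∈ 𝒱.block k ↔ ∃ t : ℕ, p^[t] i = R k := by
  refine ⟨h.reaches k i, ?_⟩
  rintro ⟨t, ht⟩
  obtain ⟨l, hl⟩ := 𝒱.exists_block i
  have key : ∀ s : ℕ, p^[s] i ∈ 𝒱.block l := by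
    intro s
    induction s with
    | zero => exact hl
    | succ s ih =>
      rw [Function.iterate_succ_apply']
      exact h.mem_block l _ ih
  have := key t
  rw [ht] at this
  rwa [𝒱.block_unique (h.root_mem k) this]

/-- The contribution of a forest given by its parent map, a factor `lam * r` being attached to
every root. -/
def forestWeight {n : ℕ} {Y : Type*} (r : Y → ℝ) (f : Y → Y → ℝ) (lam : ℝ) (y : Fin n → Y)
    (p : Fin n → Fin n) : ℝ :=
  ∏ i, if p i = i then lam * r (y i) else f (y i) (y (p i))

theorem forestWeight_nonneg {n : ℕ} {Y : Type*} {r : Y → ℝ} {f : Y → Y → ℝ} {lam : ℝ}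
    (hr : ∀ x, 0 ≤ r x) (hf : ∀ x x', 0 ≤ f x x') (hlam : 0 ≤ lam) (y : Fin n → Y)
    (p : Fin n → Fin n) : 0 ≤ forestWeight r f lam y p := by
  refine Finset.prod_nonneg fun i _ => ?_
  split_ifs
  · exact mul_nonneg hlam (hr _)
  · exact hf _ _

/-- Each vertex is either a root or the child of exactly one edge, so the product over trees becomes
a product over vertices, with one `lam` absorbed by each root. -/
theorem IsParentMap.likelihood_mul_pow {n : ℕ} {Y : Type*} {𝒱 : LabeledPartition n}
    {E : Fin 𝒱.size → Finset (Fin n × Fin n)} {R : Fin 𝒱.size → Fin n} {p : Fin n → Fin n}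
    (h : IsParentMap 𝒱 E R p) (r : Y → ℝ) (f : Y → Y → ℝ) (lam : ℝ) (y : Fin n → Y) :
    likelihood r f y E R * lam ^ 𝒱.size = forestWeight r f lam y p := by
  choose b hb using 𝒱.exists_block
  have hfib : ∀ k, Finset.univ.filter (fun i => b i = k) = 𝒱.block k := by
    intro k
    ext i
    simp only [Finset.mem_filter, Finset.mem_univ, true_and]
    exact ⟨fun e => e ▸ hb i, fun hi => 𝒱.block_unique (hb i) hi⟩
  have hpow : lam ^ 𝒱.size = ∏ _k : Fin 𝒱.size, lam := by simp
  rw [likelihood, forestWeight, hpow, ← Finset.prod_mul_distrib,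
    ← Finset.prod_fiberwise (Finset.univ : Finset (Fin n)) b]
  refine Finset.prod_congr rfl fun k _ => ?_
  rw [hfib, ← Finset.mul_prod_erase _ _ (h.root_mem k),
    if_pos ((h.fixed_iff k _ (h.root_mem k)).2 rfl)]
  have hE : E k = ((𝒱.block k).erase (R k)).image (fun i => (i, p i)) := by
    ext ⟨i, j⟩
    rw [h.mem_edges]
    simp only [Finset.mem_image, Finset.mem_erase, Prod.mk.injEq]
    constructor
    · rintro ⟨hi, hne, rfl⟩
      exact ⟨i, ⟨hne, hi⟩, rfl, rfl⟩
    · rintro ⟨i', ⟨hne, hi⟩, rfl, rfl⟩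
      exact ⟨hi, hne, rfl⟩
  have hprod : ∏ e ∈ E k, f (y e.1) (y e.2) = ∏ i ∈ (𝒱.block k).erase (R k),
      (if p i = i then lam * r (y i) else f (y i) (y (p i))) := by
    rw [hE, Finset.prod_image (fun a _ a' _ e => (Prod.mk.inj e).1)]
    refine Finset.prod_congr rfl fun i hi => ?_
    rw [Finset.mem_erase] at hi
    rw [if_neg (fun e => hi.1 ((h.fixed_iff k i hi.2).1 e))]
  rw [hprod]
  ring

/-! ### Regrafting a forest onto the label classes. -/

/-- A vertex is exposed if it is a root or if its parent carries a different label. -/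
def Exposed {n : ℕ} (c : Fin n → ℕ) (p : Fin n → Fin n) (i : Fin n) : Prop :=
  p i = i ∨ c (p i) ≠ c i

/-- `p'` arises from `p` by attaching the exposed vertices of each label class to a single exposed
vertex `ρ ℓ` of that class. -/
structure IsRegrafting {n : ℕ} (c : Fin n → ℕ) (p p' : Fin n → Fin n) (ρ : ℕ → Fin n) :
    Prop where
  label_root : ∀ i, c (ρ (c i)) = c i
  exposed_root : ∀ i, Exposed c p (ρ (c i))
  of_exposed : ∀ i, Exposed c p i → p' i = ρ (c i)
  of_not_exposed : ∀ i, ¬ Exposed c p i → p' i = p i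

/-- `p` is the parent map of a forest with exactly one tree on each label class, the root of the
class of `i` being `ρ (c i)`. -/
structure IsLabelForest {n : ℕ} (c : Fin n → ℕ) (p : Fin n → Fin n) (ρ : ℕ → Fin n) : Prop where
  label_parent : ∀ i, c (p i) = c i
  label_root : ∀ i, c (ρ (c i)) = c i
  fixed_iff : ∀ i, p i = i ↔ i = ρ (c i)
  reaches : ∀ i, ∃ t : ℕ, p^[t] i = ρ (c i)

/-- The path from `i` to its root keeps its label until it meets its first exposed vertex, and the
root itself is exposed. -/
theorem exists_exposed {n : ℕ} (c : Fin n → ℕ) (p : Fin n → Fin n) (t : ℕ) (i : Fin n)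
    (h : p (p^[t] i) = p^[t] i) : ∃ e, Exposed c p e ∧ c e = c i := by
  induction t generalizing i with
  | zero => exact ⟨i, Or.inl h, rfl⟩
  | succ t ih =>
    by_cases hi : Exposed c p i
    · exact ⟨i, hi, rfl⟩
    · obtain ⟨e, he, hc⟩ := ih (p i) h
      rw [Exposed, not_or, not_not] at hi
      exact ⟨e, he, hc.trans hi.2⟩

theorem exists_isRegrafting {n : ℕ} [NeZero n] (c : Fin n → ℕ) (p : Fin n → Fin n)
    (h : ∀ i, ∃ t : ℕ, p (p^[t] i) = p^[t] i) : ∃ p' ρ, IsRegrafting c p p' ρ := by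
  have hex : ∀ ℓ : ℕ, ∃ e, ∀ i, c i = ℓ → Exposed c p e ∧ c e = ℓ := by
    intro ℓ
    by_cases hℓ : ∃ i, c i = ℓ
    · obtain ⟨i, rfl⟩ := hℓ
      obtain ⟨t, ht⟩ := h i
      obtain ⟨e, he⟩ := exists_exposed c p t i ht
      exact ⟨e, fun _ _ => he⟩
    -- For a label that does not occur, `ρ` takes an arbitrary value.
    · exact ⟨0, fun i hi => absurd ⟨i, hi⟩ hℓ⟩
  choose ρ hρ using hex
  exact ⟨fun i => if Exposed c p i then ρ (c i) else p i, ρ, fun i => (hρ _ i rfl).2,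
    fun i => (hρ _ i rfl).1, fun i hi => if_pos hi, fun i hi => if_neg hi⟩

/-- Below the first exposed vertex the path under `p'` is the one under `p`; from there a single
step leads to the class root. -/
theorem IsRegrafting.isLabelForest {n : ℕ} {c : Fin n → ℕ} {p p' : Fin n → Fin n}
    {ρ : ℕ → Fin n} (h : IsRegrafting c p p' ρ)
    (hp : ∀ i, ∃ t : ℕ, p (p^[t] i) = p^[t] i) : IsLabelForest c p' ρ where
  label_parent i := by
    by_cases hi : Exposed c p i
    · rw [h.of_exposed i hi, h.label_root]
    · rw [h.of_not_exposed i hi]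
      rw [Exposed, not_or, not_not] at hi
      exact hi.2
  label_root := h.label_root
  fixed_iff i := by
    by_cases hi : Exposed c p i
    · rw [h.of_exposed i hi, eq_comm]
    · rw [h.of_not_exposed i hi]
      refine ⟨fun e => absurd (Or.inl e) hi, fun e => absurd ?_ hi⟩
      rw [e]
      exact h.exposed_root i
  reaches i := by
    obtain ⟨t, ht⟩ := hp i
    induction t generalizing i with
    | zero => exact ⟨1, h.of_exposed i (Or.inl ht)⟩
    | succ t ih =>
      by_cases hi : Exposed c p i
      · exact ⟨1, h.of_exposed i hi⟩
      · obtain ⟨s, hs⟩ := ih (p i) ht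
        refine ⟨s + 1, ?_⟩
        rw [Function.iterate_succ_apply, h.of_not_exposed i hi, hs]
        rw [Exposed, not_or, not_not] at hi
        rw [hi.2]

/-- The edges of `p` that join different labels. -/
def crossEdges {n : ℕ} (c : Fin n → ℕ) (p : Fin n → Fin n) : Finset (Fin n × Fin n) :=
  (Finset.univ.filter fun i => c (p i) ≠ c i).image fun i => (i, p i)

theorem mem_crossEdges {n : ℕ} {c : Fin n → ℕ} {p : Fin n → Fin n} {i j : Fin n} :
    (i, j) ∈ crossEdges c p ↔ c (p i) ≠ c i ∧ p i = j := by
  simp only [crossEdges, Finset.mem_image, Finset.mem_filter, Finset.mem_univ, true_and,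
    Prod.mk.injEq]
  constructor
  · rintro ⟨i', h, rfl, rfl⟩
    exact ⟨h, rfl⟩
  · rintro ⟨h, rfl⟩
    exact ⟨i, h, rfl, rfl⟩

theorem card_crossEdges {n : ℕ} (c : Fin n → ℕ) (p : Fin n → Fin n) :
    (crossEdges c p).card = (Finset.univ.filter fun i => c (p i) ≠ c i).card :=
  Finset.card_image_of_injective _ fun _ _ e => (Prod.mk.inj e).1

/-- Regrafting erases information only at exposed vertices: the parent of a root is itself, the
parent across labels is listed in `crossEdges`, and every other parent is still visible in `p'`. -/
theorem IsRegrafting.eq_of_eq {n : ℕ} {c : Fin n → ℕ} {p q p' : Fin n → Fin n} {ρ σ : ℕ → Fin n}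
    (hp : IsRegrafting c p p' ρ) (hq : IsRegrafting c q p' σ)
    (hfix : ∀ i, p i = i ↔ q i = i) (hcross : crossEdges c p = crossEdges c q) : p = q := by
  funext i
  by_cases hi : p i = i
  · rw [hi, (hfix i).1 hi]
  by_cases h1 : c (p i) ≠ c i
  · have : (i, p i) ∈ crossEdges c q := hcross ▸ mem_crossEdges.2 ⟨h1, rfl⟩
    exact (mem_crossEdges.1 this).2.symm
  by_cases h2 : c (q i) ≠ c i
  · have : (i, q i) ∈ crossEdges c p := hcross ▸ mem_crossEdges.2 ⟨h2, rfl⟩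
    exact (mem_crossEdges.1 this).2
  rw [← hp.of_not_exposed i (not_or.2 ⟨hi, h1⟩),
    hq.of_not_exposed i (not_or.2 ⟨fun e => hi ((hfix i).2 e), h2⟩)]

theorem IsParentMap.exists_iterate_fixed {n : ℕ} {𝒱 : LabeledPartition n}
    {E : Fin 𝒱.size → Finset (Fin n × Fin n)} {R : Fin 𝒱.size → Fin n} {p : Fin n → Fin n}
    (h : IsParentMap 𝒱 E R p) (i : Fin n) : ∃ t : ℕ, p (p^[t] i) = p^[t] i := by
  obtain ⟨k, hk⟩ := 𝒱.exists_block i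
  obtain ⟨t, ht⟩ := h.reaches k i hk
  refine ⟨t, ?_⟩
  rw [ht]
  exact (h.fixed_iff k _ (h.root_mem k)).2 rfl

/-! ### Forests of the oracle partition. -/

theorem mem_block_oraclePartition {z : ℕ → ℕ} {n : ℕ} (k : Fin (oraclePartition z n).size)
    (i : Fin n) : i ∈ (oraclePartition z n).block k ↔
      z i = (oracleLabels z n).orderEmbOfFin rfl k := by
  simp [oraclePartition, LabeledPartition.block]

theorem mem_block_oraclePartition_iff_eq {z : ℕ → ℕ} {n : ℕ} {k : Fin (oraclePartition z n).size}
    {i j : Fin n} (hi : i ∈ (oraclePartition z n).block k) :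
    j ∈ (oraclePartition z n).block k ↔ z j = z i := by
  rw [mem_block_oraclePartition] at hi ⊢
  rw [hi]

/-- A forest each of whose edges respects the labels, with one root per label, induces the oracle
partition. -/
theorem IsParentMap.equivalent_oraclePartition {z : ℕ → ℕ} {n : ℕ} {𝒱 : LabeledPartition n}
    {E : Fin 𝒱.size → Finset (Fin n × Fin n)} {R : Fin 𝒱.size → Fin n} {p : Fin n → Fin n}
    (h : IsParentMap 𝒱 E R p) (hlabel : ∀ i, z (p i) = z i)
    (hroot : ∀ i j, p i = i → p j = j → z i = z j → i = j) :
    Equivalent 𝒱 (oraclePartition z n) := by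
  have hRfix : ∀ k, p (R k) = R k := fun k => (h.fixed_iff k _ (h.root_mem k)).2 rfl
  have hz : ∀ k, ∀ i ∈ 𝒱.block k, z i = z (R k) := by
    intro k i hi
    obtain ⟨t, ht⟩ := h.reaches k i hi
    rw [← ht]
    clear ht
    induction t with
    | zero => rfl
    | succ t ih => rw [Function.iterate_succ_apply', hlabel, ih]
  choose b hb using fun k => (oraclePartition z n).exists_block (R k)
  have hbinj : Function.Injective b := by
    intro k l hkl
    have h1 := hb k
    rw [hkl, mem_block_oraclePartition_iff_eq (hb l)] at h1
    exact h.root_injective (hroot _ _ (hRfix k) (hRfix l) h1)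
  have hbsurj : Function.Surjective b := by
    intro l
    obtain ⟨i, hi⟩ := (oraclePartition z n).2.2.1 l
    obtain ⟨k, hk⟩ := 𝒱.exists_block i
    refine ⟨k, (oraclePartition z n).block_unique (hb k) ?_⟩
    exact (mem_block_oraclePartition_iff_eq hi).2 (hz k i hk).symm
  refine ⟨Equiv.ofBijective b ⟨hbinj, hbsurj⟩, fun k => ?_⟩
  ext i
  change i ∈ 𝒱.block k ↔ i ∈ (oraclePartition z n).block (b k)
  rw [mem_block_oraclePartition_iff_eq (hb k)]
  refine ⟨hz k i, fun hi => ?_⟩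
  obtain ⟨l, hl⟩ := 𝒱.exists_block i
  have : R l = R k := hroot _ _ (hRfix l) (hRfix k) ((hz l i hl).symm.trans hi)
  rwa [← h.root_injective this]

theorem IsLabelForest.isParentMap {z : ℕ → ℕ} {n : ℕ} {p : Fin n → Fin n} {ρ : ℕ → Fin n}
    (h : IsLabelForest (fun i : Fin n => z i) p ρ) :
    IsParentMap (oraclePartition z n)
      (fun k => (((oraclePartition z n).block k).filter fun i => p i ≠ i).image fun i => (i, p i))
      (fun k => ρ ((oracleLabels z n).orderEmbOfFin rfl k)) p where
  root_mem k := by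
    obtain ⟨i, hi⟩ := (oraclePartition z n).2.2.1 k
    have hi' := (mem_block_oraclePartition k i).1 hi
    rw [mem_block_oraclePartition_iff_eq hi, ← hi']
    exact h.label_root i
  fixed_iff k i hi := by
    rw [← (mem_block_oraclePartition k i).1 hi]
    exact h.fixed_iff i
  mem_block k i hi := (mem_block_oraclePartition_iff_eq hi).2 (h.label_parent i)
  mem_edges k i j := by
    simp only [Finset.mem_image, Finset.mem_filter, Prod.mk.injEq]
    constructor
    · rintro ⟨i', ⟨hi, hne⟩, rfl, rfl⟩
      refine ⟨hi, ?_, rfl⟩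
      rw [← (mem_block_oraclePartition k i').1 hi]
      exact fun e => hne ((h.fixed_iff i').2 e)
    · rintro ⟨hi, hne, rfl⟩
      rw [← (mem_block_oraclePartition k i).1 hi] at hne
      exact ⟨i, ⟨hi, fun e => hne ((h.fixed_iff i).1 e)⟩, rfl, rfl⟩
  reaches k i hi := by
    rw [← (mem_block_oraclePartition k i).1 hi]
    exact h.reaches i

end BSF
namespace BSF

/-! ### Comparison of weights before and after regrafting. -/

/-- `N` is the charge on an exposed vertex, `B` the price of a vertex that is a root after
regrafting, `η` the gain from removing a cross-label edge or a superfluous root. Unexposed vertices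
keep their factor. -/
theorem forestWeight_factor_le {n : ℕ} {Y : Type*} {r : Y → ℝ} {f : Y → Y → ℝ} {lam : ℝ}
    {y : Fin n → Y} {c : Fin n → ℕ} {p p' : Fin n → Fin n} {ρ : ℕ → Fin n}
    (h : IsRegrafting c p p' ρ) {a C₁ C₂ ε M N B η : ℝ} (ha : 0 < a) (hN : 0 ≤ N)
    (hB : 0 ≤ B) (hη : 0 ≤ η) (hη1 : η ≤ 1) (hC₂ : 1 ≤ C₂)
    (hεη : ε ≤ η) (hNB : N * C₂ ≤ B * C₁) (hNη : N * C₂ ≤ η * M)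
    (hroot : ∀ i, C₁ * a ≤ lam * r (y i) ∧ lam * r (y i) ≤ C₂ * a)
    (hcross : ∀ i j, c i ≠ c j → f (y i) (y j) ≤ a * ε)
    (hsame : ∀ i j, i ≠ j → c i = c j → a * M ≤ f (y i) (y j)) (i : Fin n) :
    (if p i = i then lam * r (y i) else f (y i) (y (p i))) * (if Exposed c p i then N else 1) ≤
      (if p' i = i then lam * r (y i) else f (y i) (y (p' i))) * (if p' i = i then B else 1) *
        (if c (p i) ≠ c i ∨ (Exposed c p i ∧ p' i ≠ i) then η else 1) := by
  have hNN : N ≤ N * C₂ := le_mul_of_one_le_right hN hC₂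
  by_cases he : Exposed c p i
  · have hlab : c (p' i) = c i := by rw [h.of_exposed i he, h.label_root]
    by_cases hp : p i = i
    · have hc : c (p i) = c i := by rw [hp]
      by_cases hp' : p' i = i
      · simp only [hp, hp', he, if_true, ne_eq, not_true_eq_false, and_false, or_self, if_false,
          mul_one]
        calc lam * r (y i) * N ≤ C₂ * a * N := mul_le_mul_of_nonneg_right (hroot i).2 hN
          _ = a * (N * C₂) := by ring
          _ ≤ a * (B * C₁) := mul_le_mul_of_nonneg_left hNB ha.le
          _ = C₁ * a * B := by ring
          _ ≤ _ := mul_le_mul_of_nonneg_right (hroot i).1 hB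
      · simp only [hp, hp', he, if_true, ne_eq, not_true_eq_false, not_false_eq_true, and_self,
          false_or, if_false, mul_one]
        calc lam * r (y i) * N ≤ C₂ * a * N := mul_le_mul_of_nonneg_right (hroot i).2 hN
          _ = a * (N * C₂) := by ring
          _ ≤ a * (η * M) := mul_le_mul_of_nonneg_left hNη ha.le
          _ = a * M * η := by ring
          _ ≤ _ := mul_le_mul_of_nonneg_right (hsame _ _ (Ne.symm hp') hlab.symm) hη
    · have hc : c (p i) ≠ c i := he.resolve_left hp
      have hf := hcross i (p i) hc.symm
      by_cases hp' : p' i = i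
      · simp only [hp, hp', he, if_true, ne_eq, hc, not_false_eq_true, true_or, if_false]
        calc f (y i) (y (p i)) * N ≤ a * ε * N := mul_le_mul_of_nonneg_right hf hN
          _ ≤ a * η * N := by gcongr
          _ ≤ a * η * (N * C₂) := by gcongr
          _ ≤ a * η * (B * C₁) := by gcongr
          _ = C₁ * a * B * η := by ring
          _ ≤ _ := by
            have := (hroot i).1
            gcongr
      · simp only [hp, hp', he, if_true, ne_eq, hc, not_false_eq_true, true_or, if_false, mul_one]
        calc f (y i) (y (p i)) * N ≤ a * ε * N := mul_le_mul_of_nonneg_right hf hN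
          -- Here `ε` is needed only through `ε ≤ 1`: the new within-label edge supplies the gain
          -- `η`.
          _ ≤ a * 1 * N := by
            have := hεη.trans hη1
            gcongr
          _ ≤ a * (η * M) := by
            rw [mul_one]
            exact mul_le_mul_of_nonneg_left (hNN.trans hNη) ha.le
          _ = a * M * η := by ring
          _ ≤ _ := mul_le_mul_of_nonneg_right (hsame _ _ (Ne.symm hp') hlab.symm) hη
  · have hp' := h.of_not_exposed i he
    have he' := he
    rw [Exposed, not_or, not_not] at he'
    simp [hp', he, he'.1, he'.2]

theorem IsLabelForest.card_fixed_le {z : ℕ → ℕ} {n : ℕ} {p : Fin n → Fin n} {ρ : ℕ → Fin n}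
    (h : IsLabelForest (fun i : Fin n => z i) p ρ) :
    (Finset.univ.filter fun i => p i = i).card ≤ oracleSize z n := by
  refine Finset.card_le_card_of_injOn (fun i => z i)
    (fun i _ => Finset.mem_image_of_mem (fun i : Fin n => z i) (Finset.mem_univ i)) ?_
  intro i hi j hj hij
  replace hi := (Finset.mem_filter.1 hi).2
  replace hj := (Finset.mem_filter.1 hj).2
  rw [(h.fixed_iff i).1 hi, (h.fixed_iff j).1 hj]
  exact congrArg ρ hij

theorem card_exposed {n : ℕ} (c : Fin n → ℕ) (p : Fin n → Fin n) :
    (Finset.univ.filter fun i => Exposed c p i).card =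
      (Finset.univ.filter fun i => p i = i).card + (crossEdges c p).card := by
  rw [card_crossEdges, ← Finset.card_union_of_disjoint]
  · congr 1
    ext i
    simp only [Finset.mem_union, Finset.mem_filter, Finset.mem_univ, true_and]
    exact Iff.rfl
  · rw [Finset.disjoint_left]
    intro i hi hi'
    simp only [Finset.mem_filter, Finset.mem_univ, true_and] at hi hi'
    rw [hi] at hi'
    exact hi' rfl

theorem IsParentMap.card_fixed {n : ℕ} {𝒱 : LabeledPartition n}
    {E : Fin 𝒱.size → Finset (Fin n × Fin n)} {R : Fin 𝒱.size → Fin n} {p : Fin n → Fin n}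
    (h : IsParentMap 𝒱 E R p) : (Finset.univ.filter fun i => p i = i).card = 𝒱.size := by
  have : (Finset.univ.filter fun i => p i = i) = Finset.univ.image R := by
    ext i
    simp [h.fixed_iff_mem_range]
  rw [this, Finset.card_image_of_injective _ h.root_injective, Finset.card_univ, Fintype.card_fin]

/-- The data entering the comparison of forest weights on a fixed sample: `a` is the scale of a
root, `a * ε` bounds the kernel between labels, `a * M` bounds it from below within a label. -/
structure Separated {n : ℕ} {Y : Type*} (r : Y → ℝ) (f : Y → Y → ℝ) (lam : ℝ) (y : Fin n → Y)
    (c : Fin n → ℕ) (a C₁ C₂ ε M : ℝ) : Prop where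
  root : ∀ i, C₁ * a ≤ lam * r (y i) ∧ lam * r (y i) ≤ C₂ * a
  cross : ∀ i j, c i ≠ c j → f (y i) (y j) ≤ a * ε
  same : ∀ i j, i ≠ j → c i = c j → a * M ≤ f (y i) (y j)

/-- Multiplying the vertexwise bounds, `B` occurs at most once per label, and a forest off the
oracle partition gains at least one factor `η`; since `η ≤ 1`, keeping just one suffices. -/
theorem forestWeight_mul_pow_le {n : ℕ} {Y : Type*} {r : Y → ℝ} {f : Y → Y → ℝ} {lam : ℝ}
    {y : Fin n → Y} {z : ℕ → ℕ} {𝒱 : LabeledPartition n}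
    {E : Fin 𝒱.size → Finset (Fin n × Fin n)} {R : Fin 𝒱.size → Fin n}
    {p p' : Fin n → Fin n} {ρ : ℕ → Fin n}
    (hr : ∀ x, 0 ≤ r x) (hf : ∀ x x', 0 ≤ f x x') (hlam : 0 ≤ lam)
    (hp : IsParentMap 𝒱 E R p) (h : IsRegrafting (fun i : Fin n => z i) p p' ρ)
    (hne : ¬ Equivalent 𝒱 (oraclePartition z n))
    {a C₁ C₂ ε M N B η : ℝ} (ha : 0 < a) (hN : 0 ≤ N)
    (hB : 1 ≤ B) (hη : 0 ≤ η) (hη1 : η ≤ 1) (hC₂ : 1 ≤ C₂)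
    (hεη : ε ≤ η) (hNB : N * C₂ ≤ B * C₁) (hNη : N * C₂ ≤ η * M)
    (hsep : Separated r f lam y (fun i : Fin n => z i) a C₁ C₂ ε M) :
    forestWeight r f lam y p * N ^ (𝒱.size + (crossEdges (fun i : Fin n => z i) p).card) ≤
      forestWeight r f lam y p' * (B ^ oracleSize z n * η) := by
  set c : Fin n → ℕ := fun i => z i with hc
  have hforest := h.isLabelForest hp.exists_iterate_fixed
  have hprod := Finset.prod_le_prod (s := (Finset.univ : Finset (Fin n))) (fun i _ => ?_)
    (fun i _ => forestWeight_factor_le h ha hN (zero_le_one.trans hB) hη hη1 hC₂ hεη hNB hNη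
      hsep.root hsep.cross hsep.same i)
  swap
  · refine mul_nonneg ?_ ?_
    · split_ifs
      · exact mul_nonneg hlam (hr _)
      · exact hf _ _
    · split_ifs
      · exact hN
      · exact zero_le_one
  rw [Finset.prod_mul_distrib, Finset.prod_mul_distrib, Finset.prod_mul_distrib] at hprod
  change forestWeight r f lam y p * _ ≤ forestWeight r f lam y p' * _ * _ at hprod
  rw [Finset.prod_ite, Finset.prod_const_one, Finset.prod_const, mul_one,
    card_exposed, hp.card_fixed] at hprod
  refine hprod.trans ?_
  rw [mul_assoc]
  refine mul_le_mul_of_nonneg_left ?_ (forestWeight_nonneg hr hf hlam y p')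
  refine mul_le_mul ?_ ?_ ?_ ?_
  · rw [Finset.prod_ite, Finset.prod_const_one, Finset.prod_const, mul_one]
    exact pow_le_pow_right₀ hB hforest.card_fixed_le
  · rw [Finset.prod_ite, Finset.prod_const_one, Finset.prod_const, mul_one]
    refine pow_le_of_le_one hη hη1 ?_
    rw [Finset.card_ne_zero]
    -- With no gain anywhere, all edges respect the labels and all roots remain roots, at most one
    -- per label; the forest would then induce the oracle partition.
    by_contra hempty
    rw [Finset.not_nonempty_iff_eq_empty, Finset.filter_eq_empty_iff] at hempty
    have hall : ∀ i, c (p i) = c i ∧ (p i = i → p' i = i) := by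
      intro i
      have := hempty (Finset.mem_univ i)
      rw [not_or, not_not] at this
      refine ⟨this.1, fun hi => ?_⟩
      by_contra hi'
      exact this.2 ⟨Or.inl hi, hi'⟩
    refine hne (hp.equivalent_oraclePartition (fun i => (hall i).1) fun i j hi hj hij => ?_)
    rw [(hforest.fixed_iff i).1 ((hall i).2 hi), (hforest.fixed_iff j).1 ((hall j).2 hj)]
    exact congrArg ρ hij
  · refine Finset.prod_nonneg fun i _ => ?_
    split_ifs
    · exact hη
    · exact zero_le_one
  · exact pow_nonneg (zero_le_one.trans hB) _

/-! ### Summation over all forests. -/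

/-- A labelled partition together with a candidate edge set and root for every cluster. -/
abbrev LabeledForest (n : ℕ) : Type :=
  Σ 𝒱 : LabeledPartition n, (Fin 𝒱.size → Finset (Fin n × Fin n)) × (Fin 𝒱.size → Fin n)

/-- Every cluster carries a rooted spanning tree. -/
def LabeledForest.IsSpanning {n : ℕ} (X : LabeledForest n) : Prop :=
  ∀ k, IsRootedSpanningTree (X.1.block k) (X.2.1 k) (X.2.2 k)

theorem weight_eq_sum {n : ℕ} {Y : Type*} (r : Y → ℝ) (f : Y → Y → ℝ) (lam : ℝ) (y : Fin n → Y)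
    (𝒱 : LabeledPartition n) : weight r f lam y 𝒱 =
      ∑ x : (Fin 𝒱.size → Finset (Fin n × Fin n)) × (Fin 𝒱.size → Fin n),
        if LabeledForest.IsSpanning ⟨𝒱, x⟩ then
          likelihood r f y x.1 x.2 * lam ^ 𝒱.size else 0 := by
  rw [Fintype.sum_prod_type]
  exact Finset.sum_congr rfl fun E _ => Finset.sum_congr rfl fun R _ => if_congr Iff.rfl rfl rfl

theorem weight_nonneg {n : ℕ} {Y : Type*} {r : Y → ℝ} {f : Y → Y → ℝ} {lam : ℝ}
    (hr : ∀ x, 0 ≤ r x) (hf : ∀ x x', 0 ≤ f x x') (hlam : 0 ≤ lam) (y : Fin n → Y)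
    (𝒱 : LabeledPartition n) : 0 ≤ weight r f lam y 𝒱 := by
  refine Finset.sum_nonneg fun E _ => Finset.sum_nonneg fun R _ => ?_
  split_ifs
  · exact mul_nonneg (Finset.prod_nonneg fun k _ => mul_nonneg (hr _)
      (Finset.prod_nonneg fun e _ => hf _ _)) (pow_nonneg hlam _)
  · exact le_rfl

/-- A parent map can be read off its edge sets and roots, so label forests inject into the
nonnegative terms of the oracle weight. -/
theorem sum_labelForest_le_weight {n : ℕ} {Y : Type*} {r : Y → ℝ} {f : Y → Y → ℝ} {lam : ℝ}
    (hr : ∀ x, 0 ≤ r x) (hf : ∀ x x', 0 ≤ f x x') (hlam : 0 ≤ lam) (y : Fin n → Y) (z : ℕ → ℕ) :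
    (∑ p : Fin n → Fin n, if ∃ ρ, IsLabelForest (fun i : Fin n => z i) p ρ then
      forestWeight r f lam y p else 0) ≤ weight r f lam y (oraclePartition z n) := by
  set 𝒱 := oraclePartition z n
  set S : Finset (Fin n → Fin n) :=
    Finset.univ.filter fun p => ∃ ρ, IsLabelForest (fun i : Fin n => z i) p ρ with hS
  have hex : ∀ p, ∃ x : (Fin 𝒱.size → Finset (Fin n × Fin n)) × (Fin 𝒱.size → Fin n),
      p ∈ S → IsParentMap 𝒱 x.1 x.2 p := by
    intro p
    by_cases hp : p ∈ S
    · obtain ⟨ρ, hρ⟩ := (Finset.mem_filter.1 hp).2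
      exact ⟨(_, _), fun _ => hρ.isParentMap⟩
    · by_cases hn : Nonempty (Fin n)
      · exact ⟨(fun _ => ∅, fun _ => hn.some), fun h => absurd h hp⟩
      · refine ⟨(fun _ => ∅, fun k => absurd ?_ hn), fun h => absurd h hp⟩
        exact ⟨(𝒱.2.2.1 k).choose⟩
  choose g hg using hex
  rw [← Finset.sum_filter, weight_eq_sum]
  have hinj : Set.InjOn g (S : Set (Fin n → Fin n)) := by
    intro p hp q hq hpq
    have h1 := hg p hp
    have h2 := hg q hq
    rw [← hpq] at h2
    funext i
    obtain ⟨k, hk⟩ := 𝒱.exists_block i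
    by_cases hi : i = (g p).2 k
    · rw [(h1.fixed_iff k i hk).2 hi, (h2.fixed_iff k i hk).2 hi]
    · exact ((h2.mem_edges k i _).1 ((h1.mem_edges k i _).2 ⟨hk, hi, rfl⟩)).2.2.symm
  calc ∑ p ∈ S, forestWeight r f lam y p
      = ∑ p ∈ S, (fun x : (Fin 𝒱.size → Finset (Fin n × Fin n)) × (Fin 𝒱.size → Fin n) =>
          if LabeledForest.IsSpanning ⟨𝒱, x⟩ then
          likelihood r f y x.1 x.2 * lam ^ 𝒱.size else 0) (g p) := by
        refine Finset.sum_congr rfl fun p hp => ?_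
        have h : LabeledForest.IsSpanning ⟨𝒱, g p⟩ := (hg p hp).isRootedSpanningTree
        simp only [h, if_true]
        exact ((hg p hp).likelihood_mul_pow r f lam y).symm
    _ = ∑ x ∈ S.image g, if LabeledForest.IsSpanning ⟨𝒱, x⟩ then
          likelihood r f y x.1 x.2 * lam ^ 𝒱.size else 0 := by
        rw [Finset.sum_image hinj]
    _ ≤ _ := by
        refine Finset.sum_le_sum_of_subset_of_nonneg (Finset.subset_univ _) fun x _ _ => ?_
        split_ifs
        · exact mul_nonneg (Finset.prod_nonneg fun k _ => mul_nonneg (hr _)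
            (Finset.prod_nonneg fun e _ => hf _ _)) (pow_nonneg hlam _)
        · exact le_rfl

/-- For each of the `n + 1` values of `K`, the `n ^ K` tuples have total mass one. -/
theorem sum_inv_pow_sigma {n : ℕ} (hn : 0 < n) :
    ∑ x : (Σ K : Fin (n + 1), Fin (K : ℕ) → Fin n), ((n : ℝ)⁻¹) ^ (x.1 : ℕ) = n + 1 := by
  have hn' : (n : ℝ) ≠ 0 := by positivity
  rw [Fintype.sum_sigma]
  simp [hn']

/-- With `m` elements, the binomial theorem gives `(1 + 1 / m) ^ m ≤ e`. -/
theorem sum_inv_pow_card_le {α : Type*} [Fintype α] [Nonempty α] :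
    ∑ s : Finset α, ((Fintype.card α : ℝ)⁻¹) ^ s.card ≤ 3 := by
  have h := Fintype.sum_pow_mul_eq_add_pow α ((Fintype.card α : ℝ)⁻¹) 1
  simp only [one_pow, mul_one] at h
  rw [h]
  have hpos : (Fintype.card α : ℝ) ≠ 0 := by positivity
  calc ((Fintype.card α : ℝ)⁻¹ + 1) ^ Fintype.card α
      ≤ Real.exp ((Fintype.card α : ℝ)⁻¹) ^ Fintype.card α := by
        gcongr
        exact Real.add_one_le_exp _
    _ = Real.exp 1 := by rw [← Real.exp_nat_mul, mul_inv_cancel₀ hpos]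
    _ ≤ 3 := Real.exp_one_lt_three.le

/-- A spanning forest is determined by its parent map and the ordering of its roots. -/
theorem LabeledForest.eq_of_isParentMap {n : ℕ} {X X' : LabeledForest n} {p : Fin n → Fin n}
    (h : IsParentMap X.1 X.2.1 X.2.2 p) (h' : IsParentMap X'.1 X'.2.1 X'.2.2 p)
    (hR : (⟨X.1.1, X.2.2⟩ : Σ K : Fin (n + 1), Fin (K : ℕ) → Fin n) = ⟨X'.1.1, X'.2.2⟩) :
    X = X' := by
  obtain ⟨⟨K, V, hV⟩, E, R⟩ := X
  obtain ⟨⟨K', V', hV'⟩, E', R'⟩ := X'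
  obtain rfl : K = K' := congrArg Sigma.fst hR
  obtain rfl : R = R' := eq_of_heq (Sigma.mk.inj hR).2
  obtain rfl : V = V' := by
    funext k
    ext i
    exact (h.mem_block_iff k i).trans (h'.mem_block_iff k i).symm
  obtain rfl : E = E' := by
    funext k
    ext ⟨i, j⟩
    exact (h.mem_edges k i j).trans (h'.mem_edges k i j).symm
  rfl

theorem sum_weight_not_equivalent_le {n : ℕ} {Y : Type*} {r : Y → ℝ} {f : Y → Y → ℝ} {lam : ℝ}
    {y : Fin n → Y} {z : ℕ → ℕ} (hn : 0 < n)
    (hr : ∀ x, 0 ≤ r x) (hf : ∀ x x', 0 ≤ f x x') (hlam : 0 ≤ lam)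
    {a C₁ C₂ ε M B η : ℝ} (ha : 0 < a)
    (hB : 1 ≤ B) (hη : 0 ≤ η) (hη1 : η ≤ 1) (hC₂ : 1 ≤ C₂)
    (hεη : ε ≤ η) (hNB : (n : ℝ) ^ 2 * C₂ ≤ B * C₁) (hNη : (n : ℝ) ^ 2 * C₂ ≤ η * M)
    (hsep : Separated r f lam y (fun i : Fin n => z i) a C₁ C₂ ε M) :
    (∑ 𝒱 : LabeledPartition n,
      if Equivalent 𝒱 (oraclePartition z n) then 0 else weight r f lam y 𝒱) ≤
      3 * (n + 1) * (B ^ oracleSize z n * η) * weight r f lam y (oraclePartition z n) := by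
  have : NeZero n := ⟨hn.ne'⟩
  have hn1 : (1 : ℝ) ≤ n := by exact_mod_cast hn
  have hn0 : (0 : ℝ) < n := by positivity
  set c : Fin n → ℕ := fun i => z i with hc
  set W : (Fin n → Fin n) → ℝ := fun p =>
    if ∃ ρ, IsLabelForest c p ρ then forestWeight r f lam y p else 0 with hW
  -- The summable majorant on codes: it factors into a regrafted forest, a root tuple and a set of
  -- cross edges.
  set g : (Fin n → Fin n) × (Σ K : Fin (n + 1), Fin (K : ℕ) → Fin n) × Finset (Fin n × Fin n) → ℝ :=
    fun x => W x.1 * (B ^ oracleSize z n * η) *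
      (((n : ℝ)⁻¹) ^ (x.2.1.1 : ℕ) * ((Fintype.card (Fin n × Fin n) : ℝ)⁻¹) ^ x.2.2.card) with hg
  have hW0 : ∀ p, 0 ≤ W p := by
    intro p
    simp only [hW]
    split_ifs
    · exact forestWeight_nonneg hr hf hlam y p
    · exact le_rfl
  have hκ : 0 ≤ B ^ oracleSize z n * η := by positivity
  have hg0 : ∀ x, 0 ≤ g x := fun x => by
    have := hW0 x.1
    simp only [hg]
    positivity
  have hex : ∀ X : LabeledForest n, ∃ p p' ρ, X.IsSpanning →
      IsParentMap X.1 X.2.1 X.2.2 p ∧ IsRegrafting c p p' ρ := by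
    intro X
    by_cases hX : X.IsSpanning
    · obtain ⟨p, hp⟩ := exists_isParentMap X.1 X.2.1 X.2.2 hX
      obtain ⟨p', ρ, h⟩ := exists_isRegrafting c p hp.exists_iterate_fixed
      exact ⟨p, p', ρ, fun _ => ⟨hp, h⟩⟩
    · exact ⟨id, id, fun _ => 0, fun h => absurd h hX⟩
  choose p p' ρ hp using hex
  -- The root tuple is kept ordered because it also records the labelling of the clusters.
  set code : LabeledForest n →
      (Fin n → Fin n) × (Σ K : Fin (n + 1), Fin (K : ℕ) → Fin n) × Finset (Fin n × Fin n) :=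
    fun X => (p' X, ⟨X.1.1, X.2.2⟩, crossEdges c (p X)) with hcode
  set S : Finset (LabeledForest n) :=
    Finset.univ.filter fun X => ¬ Equivalent X.1 (oraclePartition z n) ∧ X.IsSpanning with hS
  have hinj : Set.InjOn code (S : Set (LabeledForest n)) := by
    intro X hX X' hX' hXX'
    obtain ⟨h1, h2⟩ := hp X (Finset.mem_filter.1 hX).2.2
    obtain ⟨h1', h2'⟩ := hp X' (Finset.mem_filter.1 hX').2.2
    obtain ⟨e1, e⟩ := Prod.mk.inj hXX'
    obtain ⟨e2, e3⟩ := Prod.mk.inj e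
    have hrange : Set.range X.2.2 = Set.range X'.2.2 :=
      congrArg (fun x : (Σ K : Fin (n + 1), Fin (K : ℕ) → Fin n) => Set.range x.2) e2
    have hpp : p X = p X' := by
      rw [← e1] at h2'
      refine h2.eq_of_eq h2' (fun i => ?_) e3
      rw [h1.fixed_iff_mem_range, h1'.fixed_iff_mem_range, hrange]
    rw [← hpp] at h1'
    exact LabeledForest.eq_of_isParentMap h1 h1' e2
  have hterm : ∀ X ∈ S, likelihood r f y X.2.1 X.2.2 * lam ^ X.1.size ≤ g (code X) := by
    intro X hX
    obtain ⟨hne, hspan⟩ := (Finset.mem_filter.1 hX).2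
    obtain ⟨h1, h2⟩ := hp X hspan
    rw [h1.likelihood_mul_pow]
    have hle := forestWeight_mul_pow_le hr hf hlam h1 h2 hne ha (by positivity) hB hη hη1 hC₂
      hεη hNB hNη hsep
    have hWX : W (p' X) = forestWeight r f lam y (p' X) :=
      if_pos ⟨_, h2.isLabelForest h1.exists_iterate_fixed⟩
    simp only [hg, hcode, hWX]
    have hcard : (Fintype.card (Fin n × Fin n) : ℝ) = (n : ℝ) ^ 2 := by
      simp [sq]
    rw [hcard, inv_pow, inv_pow, ← mul_inv, ← div_eq_mul_inv, le_div_iff₀ (by positivity)]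
    -- The charge `n ^ 2` per root exceeds the `n` needed to count root tuples; only cross edges
    -- need all of it.
    refine le_trans (mul_le_mul_of_nonneg_left ?_ (forestWeight_nonneg hr hf hlam y (p X))) hle
    rw [pow_add]
    gcongr
    exact le_self_pow₀ hn1 two_ne_zero
  calc (∑ 𝒱 : LabeledPartition n,
      if Equivalent 𝒱 (oraclePartition z n) then 0 else weight r f lam y 𝒱)
      = ∑ X : LabeledForest n, if ¬ Equivalent X.1 (oraclePartition z n) ∧ X.IsSpanning then
          likelihood r f y X.2.1 X.2.2 * lam ^ X.1.size else 0 := by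
        refine Eq.trans (Finset.sum_congr rfl fun 𝒱 _ => ?_) (Fintype.sum_sigma _).symm
        by_cases he : Equivalent 𝒱 (oraclePartition z n)
        · simp [he]
        · simp only [he, if_false, not_false_eq_true, true_and]
          exact weight_eq_sum r f lam y 𝒱
    _ = ∑ X ∈ S, likelihood r f y X.2.1 X.2.2 * lam ^ X.1.size := by rw [hS, Finset.sum_filter]
    _ ≤ ∑ X ∈ S, g (code X) := Finset.sum_le_sum hterm
    _ = ∑ x ∈ S.image code, g x := (Finset.sum_image hinj).symm
    _ ≤ ∑ x, g x :=
        Finset.sum_le_sum_of_subset_of_nonneg (Finset.subset_univ _) fun x _ _ => hg0 x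
    _ = (∑ p, W p) * (B ^ oracleSize z n * η) *
          ((∑ x : (Σ K : Fin (n + 1), Fin (K : ℕ) → Fin n), ((n : ℝ)⁻¹) ^ (x.1 : ℕ)) *
          ∑ s : Finset (Fin n × Fin n), ((Fintype.card (Fin n × Fin n) : ℝ)⁻¹) ^ s.card) := by
        rw [Fintype.sum_prod_type, Finset.sum_mul, Finset.sum_mul]
        refine Finset.sum_congr rfl fun q _ => ?_
        rw [Finset.sum_mul_sum, Fintype.sum_prod_type, Finset.mul_sum]
        refine Finset.sum_congr rfl fun x _ => ?_
        rw [Finset.mul_sum]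
    _ ≤ weight r f lam y (oraclePartition z n) * (B ^ oracleSize z n * η) * ((n + 1) * 3) := by
        have h1 := sum_labelForest_le_weight hr hf hlam y z
        have h2 := sum_inv_pow_card_le (α := Fin n × Fin n)
        have h3 := weight_nonneg hr hf hlam y (oraclePartition z n)
        rw [sum_inv_pow_sigma hn]
        gcongr
    _ = _ := by ring

theorem posteriorNotEquivalent_eq {n : ℕ} {Y : Type*} (r : Y → ℝ) (f : Y → Y → ℝ) (lam : ℝ)
    (y : Fin n → Y) (𝒱₀ : LabeledPartition n) :
    posteriorNotEquivalent r f lam y 𝒱₀ =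
      (∑ 𝒱 : LabeledPartition n, if Equivalent 𝒱 𝒱₀ then 0 else weight r f lam y 𝒱) /
        ∑ 𝒲 : LabeledPartition n, weight r f lam y 𝒲 := by
  rw [posteriorNotEquivalent, Finset.sum_div]
  refine Finset.sum_congr rfl fun 𝒱 _ => ?_
  split_ifs
  · rw [zero_div]
  · rfl

theorem posteriorNotEquivalent_nonneg {n : ℕ} {Y : Type*} {r : Y → ℝ} {f : Y → Y → ℝ} {lam : ℝ}
    (hr : ∀ x, 0 ≤ r x) (hf : ∀ x x', 0 ≤ f x x') (hlam : 0 ≤ lam) (y : Fin n → Y)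
    (𝒱₀ : LabeledPartition n) : 0 ≤ posteriorNotEquivalent r f lam y 𝒱₀ := by
  rw [posteriorNotEquivalent_eq]
  refine div_nonneg (Finset.sum_nonneg fun 𝒱 _ => ?_)
    (Finset.sum_nonneg fun 𝒱 _ => weight_nonneg hr hf hlam y 𝒱)
  split_ifs
  · exact le_rfl
  · exact weight_nonneg hr hf hlam y 𝒱

theorem posteriorNotEquivalent_le_one {n : ℕ} {Y : Type*} {r : Y → ℝ} {f : Y → Y → ℝ} {lam : ℝ}
    (hr : ∀ x, 0 ≤ r x) (hf : ∀ x x', 0 ≤ f x x') (hlam : 0 ≤ lam) (y : Fin n → Y)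
    (𝒱₀ : LabeledPartition n) : posteriorNotEquivalent r f lam y 𝒱₀ ≤ 1 := by
  rw [posteriorNotEquivalent_eq]
  refine div_le_one_of_le₀ (Finset.sum_le_sum fun 𝒱 _ => ?_)
    (Finset.sum_nonneg fun 𝒱 _ => weight_nonneg hr hf hlam y 𝒱)
  split_ifs
  · exact weight_nonneg hr hf hlam y 𝒱
  · exact le_rfl

theorem posteriorNotEquivalent_le {n : ℕ} {Y : Type*} {r : Y → ℝ} {f : Y → Y → ℝ} {lam : ℝ}
    {y : Fin n → Y} {z : ℕ → ℕ} (hn : 0 < n)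
    (hr : ∀ x, 0 ≤ r x) (hf : ∀ x x', 0 ≤ f x x') (hlam : 0 ≤ lam)
    {a C₁ C₂ ε M B η : ℝ} (ha : 0 < a)
    (hB : 1 ≤ B) (hη : 0 ≤ η) (hη1 : η ≤ 1) (hC₂ : 1 ≤ C₂)
    (hεη : ε ≤ η) (hNB : (n : ℝ) ^ 2 * C₂ ≤ B * C₁) (hNη : (n : ℝ) ^ 2 * C₂ ≤ η * M)
    (hsep : Separated r f lam y (fun i : Fin n => z i) a C₁ C₂ ε M) :
    posteriorNotEquivalent r f lam y (oraclePartition z n) ≤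
      3 * (n + 1) * (B ^ oracleSize z n * η) := by
  rw [posteriorNotEquivalent_eq]
  have hw := fun 𝒱 (_ : 𝒱 ∈ (Finset.univ : Finset (LabeledPartition n))) =>
    weight_nonneg hr hf hlam y 𝒱
  -- The total weight is at least that of the oracle partition; if it vanishes, the quotient is zero
  -- by convention.
  refine div_le_of_le_mul₀ (Finset.sum_nonneg hw) (by positivity)
    ((sum_weight_not_equivalent_le hn hr hf hlam ha hB hη hη1 hC₂ hεη hNB hNη hsep).trans ?_)
  exact mul_le_mul_of_nonneg_left (Finset.single_le_sum hw (Finset.mem_univ _)) (by positivity)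

end BSF
namespace BSF

/-! ### From samples to expectations. -/

theorem measurable_weight {n : ℕ} {Y : Type*} [MeasurableSpace Y] {r : Y → ℝ} {f : Y → Y → ℝ}
    (hr : Measurable r) (hf : Measurable (Function.uncurry f)) (lam : ℝ)
    (𝒱 : LabeledPartition n) : Measurable fun y : Fin n → Y => weight r f lam y 𝒱 := by
  unfold weight likelihood
  refine Finset.measurable_sum _ fun E _ => Finset.measurable_sum _ fun R _ => ?_
  split_ifs
  · refine Measurable.mul_const (Finset.measurable_prod _ fun k _ => Measurable.mul ?_
      (Finset.measurable_prod _ fun e _ => ?_)) _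
    · exact hr.comp (measurable_pi_apply _)
    · have h : Measurable fun y : Fin n → Y => (y e.1, y e.2) :=
        (measurable_pi_apply e.1).prodMk (measurable_pi_apply e.2)
      exact hf.comp h
  · exact measurable_const

theorem measurable_posteriorNotEquivalent {n : ℕ} {Y : Type*} [MeasurableSpace Y] {r : Y → ℝ}
    {f : Y → Y → ℝ} (hr : Measurable r) (hf : Measurable (Function.uncurry f)) (lam : ℝ)
    (𝒱₀ : LabeledPartition n) :
    Measurable fun y : Fin n → Y => posteriorNotEquivalent r f lam y 𝒱₀ := by
  unfold posteriorNotEquivalent labeledPosterior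
  refine Finset.measurable_sum _ fun 𝒱 _ => ?_
  split_ifs
  · exact measurable_const
  · exact (measurable_weight hr hf lam 𝒱).div
      (Finset.measurable_sum _ fun 𝒲 _ => measurable_weight hr hf lam 𝒲)

/-- `D` need not be measurable, so its complement is replaced by a measurable hull of the same
measure. -/
theorem integral_le_add_measure_compl {Ω : Type*} [MeasurableSpace Ω] {μ : Measure Ω}
    [IsProbabilityMeasure μ] {g : Ω → ℝ} (hg : Integrable g μ) {κ : ℝ} (hκ : 0 ≤ κ) {D : Set Ω}
    (h1 : ∀ x, g x ≤ 1) (hD : ∀ᵐ x ∂μ, x ∈ D → g x ≤ κ) :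
    ∫ x, g x ∂μ ≤ κ + (μ Dᶜ).toReal := by
  set T := toMeasurable μ Dᶜ with hT
  have hTm : MeasurableSet T := measurableSet_toMeasurable _ _
  have hint : Integrable (T.indicator fun _ => (1 : ℝ)) μ :=
    (integrable_const (1 : ℝ)).indicator hTm
  calc ∫ x, g x ∂μ ≤ ∫ x, (κ + T.indicator (fun _ => (1 : ℝ)) x) ∂μ := by
        refine integral_mono_ae hg ((integrable_const κ).add hint) ?_
        filter_upwards [hD] with x hx
        by_cases hxT : x ∈ T
        · rw [Set.indicator_of_mem hxT]
          linarith [h1 x]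
        · rw [Set.indicator_of_notMem hxT, add_zero]
          exact hx (by_contra fun hxD => hxT (subset_toMeasurable μ Dᶜ hxD))
    _ = κ + (μ Dᶜ).toReal := by
        rw [integral_add (integrable_const κ) hint, integral_indicator_const _ hTm]
        simp [Measure.real, hT, measure_toMeasurable]

theorem separated_of_mem_niceSet {Y : Type*} {r : Y → ℝ} {f : Y → Y → ℝ} {δ lam : ℝ}
    {z : ℕ → ℕ} {c₁ c₂ ι₁ ι₂ q C₁ C₂ : ℝ} {n : ℕ} {y : Fin n → Y} (hδ : 0 < δ) (hlam : 0 < lam)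
    (hc₁ : 0 < c₁) (hc₂ : 0 < c₂) (hq : 0 < q) (hq₁ : q ≤ 1 + ι₁) (hq₂ : q ≤ 1 + ι₂)
    (hroot : ∀ i : Fin n, C₁ * δ ≤ r (y i) ∧ r (y i) ≤ C₂ * δ)
    (hy : y ∈ niceSet f δ lam z c₁ c₂ ι₁ ι₂ n) :
    Separated r f lam y (fun i : Fin n => z i) (δ * lam) (min 1 C₁) (max 1 C₂) (c₁ * (q ^ n)⁻¹)
      (q ^ n / c₂) where
  root i := by
    obtain ⟨h1, h2⟩ := hroot i
    constructor
    · calc min 1 C₁ * (δ * lam) ≤ C₁ * (δ * lam) := by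
            gcongr
            exact min_le_right _ _
        _ = lam * (C₁ * δ) := by ring
        _ ≤ _ := by gcongr
    · calc lam * r (y i) ≤ lam * (C₂ * δ) := by gcongr
        _ = C₂ * (δ * lam) := by ring
        _ ≤ _ := by
            gcongr
            exact le_max_right _ _
  cross i j hij := by
    have h := hy.1 j i (Ne.symm hij)
    -- A cross-label pair forces at least two clusters, so the base `oracleSize z n - 1 + ι₁` is at
    -- least `1 + ι₁`.
    have htwo : (2 : ℝ) ≤ oracleSize z n := by
      have : 1 < (oracleLabels z n).card := Finset.one_lt_card.2
        ⟨z i, Finset.mem_image_of_mem (fun i : Fin n => z i) (Finset.mem_univ i),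
          z j, Finset.mem_image_of_mem (fun i : Fin n => z i) (Finset.mem_univ j), hij⟩
      exact_mod_cast this
    rw [zpow_neg, zpow_natCast, div_le_iff₀ (by positivity)] at h
    refine h.trans ?_
    rw [mul_comm]
    have : q ≤ (oracleSize z n : ℝ) - 1 + ι₁ := by linarith
    gcongr
  same i j hij hz := by
    obtain ⟨hpos, h⟩ := hy.2 j i (Ne.symm hij) (Eq.symm hz)
    rw [zpow_neg, zpow_natCast, div_le_iff₀ hpos] at h
    have hq' : q ≤ (oracleSize z n : ℝ) + 1 + ι₂ := by
      have : (0 : ℝ) ≤ oracleSize z n := by positivity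
      linarith
    have h' : δ * lam ≤ c₂ * (q ^ n)⁻¹ * f (y i) (y j) := by
      refine h.trans ?_
      gcongr
    calc δ * lam * (q ^ n / c₂) ≤ c₂ * (q ^ n)⁻¹ * f (y i) (y j) * (q ^ n / c₂) := by gcongr
      _ = f (y i) (y j) := by field_simp

/-! ### Asymptotics of the bound. -/

theorem tendsto_pow_mul_inv_pow (k : ℕ) {q : ℝ} (hq : 1 < q) :
    Tendsto (fun n : ℕ => (n : ℝ) ^ k * (q ^ n)⁻¹) atTop (𝓝 0) := by
  have h := tendsto_pow_const_div_const_pow_of_one_lt k hq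
  simpa [div_eq_mul_inv] using h

/-- In logarithms: `K n ≤ √n` and `log (n ^ 2 * A) ≤ log s * √n` eventually, and the product is `n *
log s`. -/
theorem eventually_pow_le_of_isLittleO_sqrt {K : ℕ → ℕ} {A s : ℝ} (hA : 1 ≤ A) (hs : 1 < s)
    (hK : (fun n => (K n : ℝ)) =o[atTop] fun n : ℕ => Real.sqrt (n : ℝ)) :
    ∀ᶠ n : ℕ in atTop, ((n : ℝ) ^ 2 * A) ^ K n ≤ s ^ n := by
  have hlogs : 0 < Real.log s := Real.log_pos hs
  have hlog : (fun n : ℕ => Real.log ((n : ℝ) ^ 2 * A)) =o[atTop]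
      fun n : ℕ => Real.sqrt (n : ℝ) := by
    have h1 : (fun n : ℕ => Real.log (n : ℝ)) =o[atTop] fun n : ℕ => Real.sqrt (n : ℝ) := by
      have h := (isLittleO_log_rpow_atTop (r := 1 / 2) (by norm_num)).comp_tendsto
        tendsto_natCast_atTop_atTop
      refine h.congr (fun _ => rfl) fun n => ?_
      simp [Real.sqrt_eq_rpow]
    have hsq : Tendsto (fun n : ℕ => Real.sqrt (n : ℝ)) atTop atTop :=
      Real.tendsto_sqrt_atTop.comp tendsto_natCast_atTop_atTop
    have h2 : (fun _ : ℕ => Real.log A) =o[atTop] fun n : ℕ => Real.sqrt (n : ℝ) :=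
      isLittleO_const_left.2 (Or.inr (tendsto_norm_atTop_atTop.comp hsq))
    refine ((h1.const_mul_left 2).add h2).congr' ?_ EventuallyEq.rfl
    filter_upwards [eventually_gt_atTop 0] with n hn
    have : (n : ℝ) ≠ 0 := by positivity
    rw [Real.log_mul (by positivity) (by positivity), Real.log_pow]
    norm_num
  filter_upwards [hK.bound one_pos, hlog.bound hlogs, eventually_gt_atTop 0] with n h1 h2 hn
  have hn1 : (1 : ℝ) ≤ n := by exact_mod_cast hn
  have hb : 1 ≤ (n : ℝ) ^ 2 * A := one_le_mul_of_one_le_of_one_le (one_le_pow₀ hn1) hA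
  have hl : 0 ≤ Real.log ((n : ℝ) ^ 2 * A) := Real.log_nonneg hb
  rw [Real.norm_of_nonneg (by positivity), Real.norm_of_nonneg (by positivity), one_mul] at h1
  rw [Real.norm_of_nonneg hl, Real.norm_of_nonneg (by positivity)] at h2
  rw [← Real.log_le_log_iff (by positivity) (by positivity), Real.log_pow, Real.log_pow]
  calc (K n : ℝ) * Real.log ((n : ℝ) ^ 2 * A)
      ≤ Real.sqrt n * (Real.log s * Real.sqrt n) := by gcongr
    _ = (Real.sqrt n * Real.sqrt n) * Real.log s := by ring
    _ = n * Real.log s := by rw [Real.mul_self_sqrt (by positivity)]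

theorem tendsto_clustering_bound {K : ℕ → ℕ} {A D q : ℝ} (hA : 1 ≤ A) (hD : 0 ≤ D) (hq : 1 < q)
    (hK : (fun n => (K n : ℝ)) =o[atTop] fun n : ℕ => Real.sqrt (n : ℝ)) :
    Tendsto (fun n : ℕ => 3 * ((n : ℝ) + 1) *
      (((n : ℝ) ^ 2 * A) ^ K n * (D * ((n : ℝ) ^ 2 * (q ^ n)⁻¹)))) atTop (𝓝 0) := by
  -- One factor `s ^ n` of `q ^ n` absorbs the power with exponent `K n`; the other beats the
  -- polynomial.
  set s := Real.sqrt q with hs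
  have hq0 : 0 ≤ q := by linarith
  have hs1 : 1 < s := Real.lt_sqrt_of_sq_lt (by simpa using hq)
  have hsq : s * s = q := Real.mul_self_sqrt hq0
  have hlim : Tendsto (fun n : ℕ => 3 * D * ((n : ℝ) ^ 3 * (s ^ n)⁻¹ + (n : ℝ) ^ 2 * (s ^ n)⁻¹))
      atTop (𝓝 0) := by
    simpa using ((tendsto_pow_mul_inv_pow 3 hs1).add (tendsto_pow_mul_inv_pow 2 hs1)).const_mul
      (3 * D)
  refine squeeze_zero' (Eventually.of_forall fun n => by positivity) ?_ hlim
  filter_upwards [eventually_pow_le_of_isLittleO_sqrt hA hs1 hK] with n hn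
  have hsn : 0 < s ^ n := by positivity
  calc 3 * ((n : ℝ) + 1) * (((n : ℝ) ^ 2 * A) ^ K n * (D * ((n : ℝ) ^ 2 * (q ^ n)⁻¹)))
      ≤ 3 * ((n : ℝ) + 1) * (s ^ n * (D * ((n : ℝ) ^ 2 * (q ^ n)⁻¹))) := by gcongr
    _ = 3 * D * ((n : ℝ) ^ 3 * (s ^ n)⁻¹ + (n : ℝ) ^ 2 * (s ^ n)⁻¹) := by
        rw [← hsq, mul_pow]
        field_simp

end BSF
-- Conclusion.
theorem theorem1
    {Y : ℕ → Type*} [∀ n, MeasurableSpace (Y n)]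
    -- oracle memberships and oracle component distributions
    (z : ℕ → ℕ) (G : ∀ n, ℕ → Measure (Y n)) [∀ n k, IsProbabilityMeasure (G n k)]
    -- root kernel `r n x`, leaf kernel `f n x x' = f(x ∣ x'; θ_n)`, and the sequences δ, λ
    (r : ∀ n, Y n → ℝ) (f : ∀ n, Y n → Y n → ℝ) (δ lam : ℕ → ℝ)
    (hr_meas : ∀ n, Measurable (r n))
    (hf_meas : ∀ n, Measurable (Function.uncurry (f n)))
    (hr_nonneg : ∀ n x, 0 ≤ r n x)
    (hf_nonneg : ∀ n x x', 0 ≤ f n x x')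
    (hf_symm : ∀ n x x', f n x x' = f n x' x)
    (hδ : ∀ n, 0 < δ n) (hlam : ∀ n, 0 < lam n)
    -- bounded root kernel
    (C₁ C₂ : ℝ) (hC₁ : 0 < C₁) (hC₂ : 0 < C₂)
    (hroot : ∀ᶠ n in atTop, ∀ᵐ y ∂(BSF.oracleLaw (G n) z n),
      ∀ i : Fin n, C₁ * δ n ≤ r n (y i) ∧ r n (y i) ≤ C₂ * δ n)
    -- growth of the true number of clusters
    (hK : (fun n => (BSF.oracleSize z n : ℝ)) =o[atTop] (fun n => Real.sqrt (n : ℝ)))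
    -- the nice set has probability tending to one
    (c₁ c₂ ι₁ ι₂ : ℝ) (hc₁ : 0 < c₁) (hc₂ : 0 < c₂) (hι₁ : 0 < ι₁) (hι₂ : 0 < ι₂)
    (hnice : Tendsto (fun n => BSF.oracleLaw (G n) z n
      (BSF.niceSet (f n) (δ n) (lam n) z c₁ c₂ ι₁ ι₂ n)ᶜ) atTop (𝓝 0)) :
    (∀ n, Integrable
      (fun y => BSF.posteriorNotEquivalent (r n) (f n) (lam n) y (BSF.oraclePartition z n))
      (BSF.oracleLaw (G n) z n)) ∧
    Tendsto (fun n => ∫ y,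
        BSF.posteriorNotEquivalent (r n) (f n) (lam n) y (BSF.oraclePartition z n)
          ∂(BSF.oracleLaw (G n) z n)) atTop (𝓝 0) := by
  have hprob : ∀ n, IsProbabilityMeasure (BSF.oracleLaw (G n) z n) := fun n => by
    unfold BSF.oracleLaw
    infer_instance
  have hint : ∀ n, Integrable
      (fun y => BSF.posteriorNotEquivalent (r n) (f n) (lam n) y (BSF.oraclePartition z n))
      (BSF.oracleLaw (G n) z n) := fun n =>
    Integrable.of_bound
      (BSF.measurable_posteriorNotEquivalent (hr_meas n) (hf_meas n) _ _).aestronglyMeasurable 1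
      (ae_of_all _ fun y => by
        rw [Real.norm_of_nonneg (BSF.posteriorNotEquivalent_nonneg (hr_nonneg n) (hf_nonneg n)
          (hlam n).le y _)]
        exact BSF.posteriorNotEquivalent_le_one (hr_nonneg n) (hf_nonneg n) (hlam n).le y _)
  refine ⟨hint, ?_⟩
  -- A common lower bound, independent of `n`, for the bases of both exponential conditions.
  set q : ℝ := 1 + min ι₁ ι₂ with hq
  have hq1 : 1 < q := by
    have := lt_min hι₁ hι₂
    linarith
  -- Chosen so that `B = n ^ 2 * A` turns the condition on surviving roots into an equality; capping
  -- the constants at one ensures `1 ≤ A`.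
  set A : ℝ := max 1 C₂ / min 1 C₁ with hA
  have hm : 0 < min 1 C₁ := lt_min one_pos hC₁
  have hM1 : (1 : ℝ) ≤ max 1 C₂ := le_max_left _ _
  have hA1 : 1 ≤ A := (one_le_div hm).2 ((min_le_left _ _).trans hM1)
  -- With `η = D * (n ^ 2 * (q ^ n)⁻¹)`, the entry `c₁` yields `ε ≤ η`, and the other yields `N * C₂
  -- ≤ η * M` for `N = n ^ 2`, with `max 1 C₂` as `C₂`.
  set D : ℝ := max c₁ (max 1 C₂ * c₂) with hD
  have hD0 : 0 < D := lt_max_of_lt_left hc₁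
  have hbound := BSF.tendsto_clustering_bound hA1 hD0.le hq1 hK
  have hη : Tendsto (fun n : ℕ => D * ((n : ℝ) ^ 2 * (q ^ n)⁻¹)) atTop (𝓝 0) := by
    simpa using (BSF.tendsto_pow_mul_inv_pow 2 hq1).const_mul D
  have hμ : Tendsto (fun n => (BSF.oracleLaw (G n) z n
      (BSF.niceSet (f n) (δ n) (lam n) z c₁ c₂ ι₁ ι₂ n)ᶜ).toReal) atTop (𝓝 0) := by
    have h := (ENNReal.tendsto_toReal ENNReal.zero_ne_top).comp hnice
    rwa [ENNReal.toReal_zero] at h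
  have hlim := hbound.add hμ
  rw [add_zero] at hlim
  refine squeeze_zero' (Eventually.of_forall fun n => integral_nonneg fun y =>
    BSF.posteriorNotEquivalent_nonneg (hr_nonneg n) (hf_nonneg n) (hlam n).le y _) ?_ hlim
  filter_upwards [hroot, hη.eventually_le_const one_pos, eventually_gt_atTop 0]
    with n hrn hηn hn
  refine BSF.integral_le_add_measure_compl (hint n) (by positivity)
    (fun y => BSF.posteriorNotEquivalent_le_one (hr_nonneg n) (hf_nonneg n) (hlam n).le y _) ?_
  filter_upwards [hrn] with y hy hyD
  have hn1 : (1 : ℝ) ≤ (n : ℝ) ^ 2 := one_le_pow₀ (by exact_mod_cast hn)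
  refine BSF.posteriorNotEquivalent_le hn (hr_nonneg n) (hf_nonneg n) (hlam n).le
    (mul_pos (hδ n) (hlam n)) (one_le_mul_of_one_le_of_one_le hn1 hA1) (by positivity) hηn hM1
    ?_ ?_ ?_ (BSF.separated_of_mem_niceSet (q := q) (hδ n) (hlam n) hc₁ hc₂ (by positivity)
      ?_ ?_ hy hyD)
  · have h1 : c₁ ≤ D := le_max_left _ _
    calc c₁ * (q ^ n)⁻¹ ≤ D * (1 * (q ^ n)⁻¹) := by
          rw [one_mul]
          gcongr
      _ ≤ _ := by gcongr
  · rw [mul_assoc, hA, div_mul_cancel₀ _ hm.ne']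
  · have h1 : max 1 C₂ * c₂ ≤ D := le_max_right _ _
    calc (n : ℝ) ^ 2 * max 1 C₂ = (n : ℝ) ^ 2 * (max 1 C₂ * c₂) / c₂ := by field_simp
      _ ≤ (n : ℝ) ^ 2 * D / c₂ := by gcongr
      _ = _ := by field_simp
  · linarith [min_le_left ι₁ ι₂]
  · linarith [min_le_right ι₁ ι₂]
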